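/- Let $\mathbb{F}_3$ be the field with three elements. A ternary $[n,k]$ code is a $k$-dimensional linear subspace $C$ of $\mathbb{F}_3^n$; its minimum weight is the smallest number of non-zero coordinates of a non-zero vector of $C$. The code $C$ is linear complementary dual (LCD) if $C\cap C^\perp=\{0\}$, where $C^\perp=\{x\in\mathbb{F}_3^n : \sum_{i=1}^n x_iy_i=0 \text{ for all } y\in C\}$. Let $d_3(n,k)$ denote the largest minimum weight among all ternary LCD $[n,k]$ codes. (i) For every integer $s\ge 0$, \[ \begin{array}{ll} d_3(121s+17,5)=81s+9, & d_3(364s+13,6)=243s+6,\\ d_3(364s+18,6)=243s+9, & d_3(1093s+14,7)=729s+6. \end{array} \] (ii) For every integer $s\ge 0$, \[ \begin{array}{ll} d_3(40s+10,4)=27s+5, & d_3(121s+11,5)=81s+5,\\ d_3(121s+15,5)=81s+8, & d_3(364s+12,6)=243s+5,\\ d_3(1093s+13,7)=729s+5, & d_3(3280s+14,8)=2187s+5. \end{array} \] -/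

import Mathlib

/-- The dual code `C^⊥ = {x ∈ F^n | ⟨x, y⟩ = 0 for all y ∈ C}`, for the standard inner product
`⟨x, y⟩ = ∑ i, x i * y i`. -/
def dualCode {F : Type*} [Field F] {n : ℕ} (C : Submodule F (Fin n → F)) :
    Submodule F (Fin n → F) where
  carrier := {x | ∀ y ∈ C, x ⬝ᵥ y = 0}
  add_mem' := by
    intro a b ha hb y hy
    rw [add_dotProduct, ha y hy, hb y hy, add_zero]
  zero_mem' := by
    intro y _
    exact zero_dotProduct y
  smul_mem' := by
    intro c x hx y hy
    rw [smul_dotProduct, hx y hy, smul_zero]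

/-- A linear code `C` is linear complementary dual (LCD) if `C ∩ C^⊥ = {0}`. -/
def IsLCD {F : Type*} [Field F] {n : ℕ} (C : Submodule F (Fin n → F)) : Prop :=
  C ⊓ dualCode C = ⊥

/-- `C` has minimum weight `d`: `d` is the least Hamming weight of a non-zero codeword of `C`.
(No `d` qualifies for the zero code.) -/
def HasMinWeight {F : Type*} [Field F] [DecidableEq F] {n : ℕ}
    (C : Submodule F (Fin n → F)) (d : ℕ) : Prop :=
  IsLeast {w : ℕ | ∃ c ∈ C, c ≠ 0 ∧ hammingNorm c = w} d

/-- The minimum weights of the LCD `[n, k]` codes over `F`. -/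
def lcdMinWeights (F : Type*) [Field F] [DecidableEq F] (n k : ℕ) : Set ℕ :=
  {d : ℕ | ∃ C : Submodule F (Fin n → F),
    Module.finrank F C = k ∧ IsLCD C ∧ HasMinWeight C d}

/-- `d = d_q(n, k)` for `F = 𝔽_q`: `d` is the largest minimum weight among all LCD `[n, k]` codes
over `F`. This includes that an LCD `[n, k]` code with minimum weight `d` exists. -/
def IsLargestLCDMinWeight (F : Type*) [Field F] [DecidableEq F] (n k d : ℕ) : Prop :=
  IsGreatest (lcdMinWeights F n k) d

/-! Adding 3^(k-1) to d adds (3^k - 1)/2 to the Griesmer length, the same step in n that one more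
copy of the simplex code costs, so every family reduces to s = 0. Existence: all non-zero simplex
words have weight 3^(k-1), divisible by 3 when k ≥ 2, so the simplex code is self-orthogonal.
Appending copies leaves the Gram matrix unchanged, and the code stays LCD
(`exists_isLCD_of_generator`). The starting codes are explicit. Upper bound: in (i) weight d + 1
violates the Griesmer bound (`griesmerLength_le_card`). In (ii) weight d + 1 = 3e would meet it with
equality, which forces a minimum-weight word into the dual (`not_isLCD_of_eq_griesmerLength`). -/

/-! ### The Griesmer bound -/

/-- The length `∑ i < k, ⌈d / 3 ^ i⌉` of the ternary Griesmer bound. -/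
def griesmerLength : ℕ → ℕ → ℕ
  | 0, _ => 0
  -- `(d + 2) / 3` is ⌈d / 3⌉, and iterated ceilings compose to ⌈d / 3 ^ i⌉.
  | k + 1, d => d + griesmerLength k ((d + 2) / 3)

theorem griesmerLength_mono (k : ℕ) : Monotone (griesmerLength k) := by
  induction k with
  | zero => exact fun _ _ _ => le_rfl
  | succ k ih =>
    intro a b hab
    exact Nat.add_le_add hab (ih (by omega))

theorem griesmerLength_succ_strictMono (k : ℕ) : StrictMono (griesmerLength (k + 1)) := by
  intro a b hab
  exact Nat.add_lt_add_of_lt_of_le hab (griesmerLength_mono k (by omega))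

/-- The number of non-zero coordinates of `v` in `S`. -/
def weightOn {ι : Type*} (S : Finset ι) (v : ι → ZMod 3) : ℕ :=
  (S.filter fun i => v i ≠ 0).card

theorem weightOn_univ {ι : Type*} [Fintype ι] (v : ι → ZMod 3) :
    weightOn Finset.univ v = hammingNorm v := rfl

/-- Where c ≠ 0, the values of v, v + c, v - c exhaust 𝔽₃, so exactly two are non-zero; where c = 0
they coincide. -/
theorem weightOn_add_sub {ι : Type*} (S : Finset ι) (c v : ι → ZMod 3) :
    weightOn S v + weightOn S (v + c) + weightOn S (v - c) =
      3 * weightOn (S.filter fun i => c i = 0) v + 2 * weightOn S c := by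
  have key : ∀ x y : ZMod 3,
      ((if x ≠ 0 then 1 else 0) + if x + y ≠ 0 then 1 else 0) + (if x - y ≠ 0 then 1 else 0) =
        (3 * if y = 0 ∧ x ≠ 0 then 1 else 0) + 2 * if y ≠ 0 then 1 else 0 := by decide
  simp only [weightOn, Finset.filter_filter, Finset.card_filter, Finset.mul_sum,
    ← Finset.sum_add_distrib]
  exact Finset.sum_congr rfl fun i _ => by convert key (v i) (c i) <;> rfl

theorem card_eq_weightOn_add {ι : Type*} (S : Finset ι) (c : ι → ZMod 3) :
    S.card = weightOn S c + (S.filter fun i => c i = 0).card := by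
  rw [add_comm, weightOn]
  exact (Finset.card_filter_add_card_filter_not (s := S) (fun i => c i = 0)).symm

section Residual

variable {ι : Type*} [Finite ι] {k : ℕ} {V : Submodule (ZMod 3) (ι → ZMod 3)}

/-- A code has a non-zero word `c` of minimum weight, and a complement of `c` in the code whose
words have weight at least a third of that of `c` off the support of `c`. -/
theorem exists_minWeight_residual (hV : Module.finrank (ZMod 3) V = k + 1) (S : Finset ι) :
    ∃ c ∈ V, c ≠ 0 ∧ (∀ v ∈ V, v ≠ 0 → weightOn S c ≤ weightOn S v) ∧
      ∃ V' : Submodule (ZMod 3) (ι → ZMod 3), Module.finrank (ZMod 3) V' = k ∧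
        V = Submodule.span (ZMod 3) {c} ⊔ V' ∧
        (∀ v ∈ V', v ≠ 0 → v + c ≠ 0 ∧ v - c ≠ 0) ∧
        ∀ v ∈ V', v ≠ 0 →
          (weightOn S c + 2) / 3 ≤ weightOn (S.filter fun i => c i = 0) v := by
  have hne : ∃ v ∈ V, v ≠ 0 := by
    refine V.exists_mem_ne_zero_of_ne_bot ?_
    rintro rfl
    simp at hV
  have hex : ∃ w, ∃ v ∈ V, v ≠ 0 ∧ weightOn S v = w := by
    obtain ⟨v, hv, h0⟩ := hne
    exact ⟨_, v, hv, h0, rfl⟩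
  classical
  obtain ⟨c, hc, hc0, hcw⟩ := Nat.find_spec hex
  have hmin : ∀ v ∈ V, v ≠ 0 → weightOn S c ≤ weightOn S v := by
    intro v hv h0
    rw [hcw]
    exact Nat.find_min' hex ⟨v, hv, h0, rfl⟩
  -- The residual code is kept as a subspace of the same ambient space; only the coordinate set S
  -- shrinks, so no restriction map is needed.
  obtain ⟨W, hW⟩ := (Submodule.span (ZMod 3) {c}).exists_isCompl
  have hcV : Submodule.span (ZMod 3) {c} ≤ V := by simpa using hc
  have hsup : Submodule.span (ZMod 3) {c} ⊔ (W ⊓ V) = V := by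
    rw [← sup_inf_assoc_of_le W hcV, hW.sup_eq_top, top_inf_eq]
  have hdisj : Disjoint (Submodule.span (ZMod 3) {c}) (W ⊓ V) :=
    hW.disjoint.mono_right inf_le_left
  have hcW : c ∉ W ⊓ V := fun h =>
    hc0 (Submodule.disjoint_def.1 hdisj c (Submodule.mem_span_singleton_self c) h)
  have hnz : ∀ v ∈ W ⊓ V, v ≠ 0 → v + c ≠ 0 ∧ v - c ≠ 0 := by
    refine fun v hv _ => ⟨fun h => hcW ?_, fun h => hcW ?_⟩
    · rw [eq_neg_of_add_eq_zero_right h]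
      exact neg_mem hv
    · rwa [← sub_eq_zero.1 h]
  refine ⟨c, hc, hc0, hmin, W ⊓ V, ?_, hsup.symm, hnz, ?_⟩
  · have h := Submodule.finrank_sup_add_finrank_inf_eq (Submodule.span (ZMod 3) {c}) (W ⊓ V)
    rw [hsup, hdisj.eq_bot, hV, finrank_bot, finrank_span_singleton hc0] at h
    omega
  · intro v hv h0
    have h1 := hmin v hv.2 h0
    have h2 := hmin _ (add_mem hv.2 hc) (hnz v hv h0).1
    have h3 := hmin _ (sub_mem hv.2 hc) (hnz v hv h0).2
    have h4 := weightOn_add_sub S c v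
    omega

/-- The ternary Griesmer bound. -/
theorem griesmerLength_le_card (hV : Module.finrank (ZMod 3) V = k) (S : Finset ι) {d : ℕ}
    (hd : ∀ v ∈ V, v ≠ 0 → d ≤ weightOn S v) : griesmerLength k d ≤ S.card := by
  induction k generalizing V S d with
  | zero => exact Nat.zero_le _
  | succ k ih =>
    obtain ⟨c, hc, hc0, -, V', hV', -, -, hres⟩ := exists_minWeight_residual hV S
    have h := ih hV' _ hres
    calc griesmerLength (k + 1) d ≤ griesmerLength (k + 1) (weightOn S c) :=
          griesmerLength_mono _ (hd c hc hc0)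
      _ ≤ S.card := by
          rw [card_eq_weightOn_add S c]
          exact Nat.add_le_add_left h _

/-- A minimum-weight word of a code meeting the Griesmer bound has weight `d`, and the residual
code meets the Griesmer bound again. -/
theorem weightOn_eq_of_card_eq_griesmerLength {S : Finset ι} {d : ℕ} {c : ι → ZMod 3}
    (hS : S.card = griesmerLength (k + 1) d) (hd : d ≤ weightOn S c)
    (hV : Module.finrank (ZMod 3) V = k)
    (hres : ∀ v ∈ V, v ≠ 0 →
      (weightOn S c + 2) / 3 ≤ weightOn (S.filter fun i => c i = 0) v) :
    weightOn S c = d ∧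
      (S.filter fun i => c i = 0).card = griesmerLength k ((d + 2) / 3) := by
  have h := griesmerLength_le_card hV _ hres
  have hcard := card_eq_weightOn_add S c
  have hle : griesmerLength (k + 1) (weightOn S c) ≤ griesmerLength (k + 1) d := by
    rw [← hS, hcard]
    exact Nat.add_le_add_left h _
  have hw : weightOn S c = d :=
    le_antisymm ((griesmerLength_succ_strictMono k).le_iff_le.1 hle) hd
  refine ⟨hw, ?_⟩
  rw [hw, hS] at hcard
  exact (Nat.add_left_cancel hcard).symm

/-- A code meeting the Griesmer bound is spanned by its words of minimum weight. -/
theorem le_span_weightOn_eq (hV : Module.finrank (ZMod 3) V = k) {S : Finset ι} {d : ℕ}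
    (hS : S.card = griesmerLength k d) (hd : ∀ v ∈ V, v ≠ 0 → d ≤ weightOn S v) :
    V ≤ Submodule.span (ZMod 3) {v | v ∈ V ∧ v ≠ 0 ∧ weightOn S v = d} := by
  induction k generalizing V S d with
  | zero =>
    rw [Submodule.finrank_eq_zero.1 hV]
    exact bot_le
  | succ k ih =>
    obtain ⟨c, hc, hc0, -, V', hV', hsup, hnz, hres⟩ := exists_minWeight_residual hV S
    obtain ⟨hw, hS'⟩ := weightOn_eq_of_card_eq_griesmerLength hS (hd c hc hc0) hV' hres
    rw [hw] at hres
    set T := {v | v ∈ V ∧ v ≠ 0 ∧ weightOn S v = d}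
    have hcT : c ∈ Submodule.span (ZMod 3) T := Submodule.subset_span ⟨hc, hc0, hw⟩
    have hV'T : V' ≤ Submodule.span (ZMod 3) T := by
      refine (ih hV' hS' hres).trans (Submodule.span_le.2 ?_)
      rintro v ⟨hv, h0, hvw⟩
      have hvV : v ∈ V := hsup ▸ Submodule.mem_sup_right hv
      have h1 := hd v hvV h0
      have h2 := hd _ (add_mem hvV hc) (hnz v hv h0).1
      have h3 := hd _ (sub_mem hvV hc) (hnz v hv h0).2
      have h4 := weightOn_add_sub S c v
      -- The three weights sum to 3⌈d/3⌉ + 2d ≤ 3d + 2, so they cannot all exceed d.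
      have h5 : weightOn S v = d ∨ weightOn S (v + c) = d ∨ weightOn S (v - c) = d := by omega
      rcases h5 with h | h | h
      · exact Submodule.subset_span ⟨hvV, h0, h⟩
      · have hT : v + c ∈ T := ⟨add_mem hvV hc, (hnz v hv h0).1, h⟩
        have := Submodule.sub_mem _ (Submodule.subset_span hT) hcT
        rwa [add_sub_cancel_right] at this
      · have hT : v - c ∈ T := ⟨sub_mem hvV hc, (hnz v hv h0).2, h⟩
        have := Submodule.add_mem _ (Submodule.subset_span hT) hcT
        rwa [sub_add_cancel] at this
    conv_lhs => rw [hsup]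
    exact sup_le (by simpa using hcT) hV'T

end Residual

/-! ### Orthogonality from weights divisible by 3 -/

/-- Non-zero elements of 𝔽₃ square to 1; hence words of weight divisible by 3 are isotropic. -/
theorem dotProduct_self_eq_hammingNorm {ι : Type*} [Fintype ι] (v : ι → ZMod 3) :
    v ⬝ᵥ v = hammingNorm v := by
  rw [hammingNorm, Finset.card_filter, Nat.cast_sum, dotProduct]
  refine Finset.sum_congr rfl fun i _ => ?_
  generalize v i = x
  revert x
  decide

/-- Polarisation, as 2 is invertible in 𝔽₃. -/
theorem dotProduct_eq_zero_of_self {ι : Type*} [Fintype ι] {v w : ι → ZMod 3}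
    (hv : v ⬝ᵥ v = 0) (hw : w ⬝ᵥ w = 0) (hvw : (v + w) ⬝ᵥ (v + w) = 0) : v ⬝ᵥ w = 0 := by
  rw [add_dotProduct, dotProduct_add, dotProduct_add, hv, hw, dotProduct_comm w v, zero_add,
    add_zero] at hvw
  revert hvw
  generalize v ⬝ᵥ w = x
  revert x
  decide

/-- A code of minimum weight divisible by `3` that meets the Griesmer bound is not LCD: a word of
minimum weight is orthogonal to the code. -/
theorem not_isLCD_of_eq_griesmerLength {n k e : ℕ} {C : Submodule (ZMod 3) (Fin n → ZMod 3)}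
    (hC : Module.finrank (ZMod 3) C = k + 1) (hn : n = griesmerLength (k + 1) (3 * e))
    (hd : ∀ v ∈ C, v ≠ 0 → 3 * e ≤ hammingNorm v) : ¬ IsLCD C := by
  intro hL
  obtain ⟨c, hc, hc0, -, V', hV', hsup, hnz, hres⟩ :=
    exists_minWeight_residual hC Finset.univ
  obtain ⟨hw, hS'⟩ := weightOn_eq_of_card_eq_griesmerLength
    (by rw [Finset.card_univ, Fintype.card_fin, hn]) (hd c hc hc0) hV' hres
  rw [hw] at hres
  have hself : ∀ v : Fin n → ZMod 3, hammingNorm v = 3 * e → v ⬝ᵥ v = 0 := by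
    intro v hv
    rw [dotProduct_self_eq_hammingNorm, hv, Nat.cast_mul]
    exact zero_mul _
  have hcd : c ∈ dualCode C := by
    have hle : C ≤ dualCode (Submodule.span (ZMod 3) {c}) := by
      have hcc : c ∈ dualCode (Submodule.span (ZMod 3) {c}) := by
        intro y hy
        obtain ⟨a, rfl⟩ := Submodule.mem_span_singleton.1 hy
        rw [dotProduct_smul, hself c hw, smul_zero]
      conv_lhs => rw [hsup]
      -- It suffices to test c against words of V' with residual weight e, since these span V'.
      refine sup_le (by simpa using hcc) ((le_span_weightOn_eq hV' hS' hres).trans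
        (Submodule.span_le.2 ?_))
      rintro v ⟨hv, h0, hvw⟩ y hy
      obtain ⟨a, rfl⟩ := Submodule.mem_span_singleton.1 hy
      have hvC : v ∈ C := hsup ▸ Submodule.mem_sup_right hv
      have h1 := hd v hvC h0
      have h2 := hd _ (add_mem hvC hc) (hnz v hv h0).1
      have h3 := hd _ (sub_mem hvC hc) (hnz v hv h0).2
      -- The weights of v, v ± c sum to 3e + 2 · 3e = 9e and each is at least 3e, so all equal 3e
      -- and these words are isotropic.
      have h4 := weightOn_add_sub Finset.univ c v
      simp only [weightOn_univ] at h4 hw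
      rw [dotProduct_smul, dotProduct_eq_zero_of_self (hself v (by omega)) (hself c hw)
        (hself _ (by omega)), smul_zero]
    intro y hy
    rw [dotProduct_comm]
    exact hle hy c (Submodule.mem_span_singleton_self c)
  have : c ∈ C ⊓ dualCode C := ⟨hc, hcd⟩
  rw [hL] at this
  exact hc0 this

/-! ### Simplex codes and extension of LCD codes -/

/-- The weight of a single coordinate. -/
def coordWeight (x : ZMod 3) : ℕ := if x ≠ 0 then 1 else 0

theorem hammingNorm_eq_sum {ι : Type*} [Fintype ι] (v : ι → ZMod 3) :
    hammingNorm v = ∑ i, coordWeight (v i) := by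
  rw [hammingNorm, Finset.card_filter]
  rfl

/-- Translation along a coordinate j with m j ≠ 0 permutes the vectors and shifts the form by any
chosen constant. Averaging over the three shifts gives density 2/3. -/
theorem three_mul_hammingNorm_affine {k : ℕ} (a : ZMod 3) {m : Fin k → ZMod 3} (hm : m ≠ 0) :
    3 * hammingNorm (fun v : Fin k → ZMod 3 => a + v ⬝ᵥ m) = 2 * 3 ^ k := by
  obtain ⟨j, hj⟩ := Function.ne_iff.1 hm
  have hj : m j ≠ 0 := hj
  have key : ∀ x y : ZMod 3, y ≠ 0 →
      coordWeight x + coordWeight (x + y) + coordWeight (x + -y) = 2 := by decide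
  have hshift : ∀ t : ZMod 3,
      (∑ v : Fin k → ZMod 3, coordWeight (a + v ⬝ᵥ m)) =
        ∑ v : Fin k → ZMod 3, coordWeight (a + v ⬝ᵥ m + t * m j) := by
    intro t
    rw [← Equiv.sum_comp (Equiv.addRight (Pi.single j t))]
    refine Finset.sum_congr rfl fun v _ => ?_
    rw [Equiv.coe_addRight, add_dotProduct, single_dotProduct, add_assoc]
  rw [hammingNorm_eq_sum]
  calc 3 * (∑ v : Fin k → ZMod 3, coordWeight (a + v ⬝ᵥ m))
      = (∑ v : Fin k → ZMod 3, coordWeight (a + v ⬝ᵥ m)) +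
          (∑ v : Fin k → ZMod 3, coordWeight (a + v ⬝ᵥ m + 1 * m j)) +
          (∑ v : Fin k → ZMod 3, coordWeight (a + v ⬝ᵥ m + -1 * m j)) := by
        rw [← hshift, ← hshift]; ring
    _ = ∑ v : Fin k → ZMod 3, 2 := by
        rw [← Finset.sum_add_distrib, ← Finset.sum_add_distrib]
        refine Finset.sum_congr rfl fun v _ => ?_
        rw [one_mul, neg_one_mul]
        exact key _ _ hj
    _ = 2 * 3 ^ k := by
        simp [ZMod.card, mul_comm]

/-- The ternary simplex code of dimension `k`: a family of `(3 ^ k - 1) / 2` vectors such that every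
non-zero linear form is non-zero at exactly `3 ^ (k - 1)` of them. -/
theorem exists_simplex (k : ℕ) : ∃ (ι : Type) (_ : Fintype ι) (p : ι → Fin k → ZMod 3),
    2 * Fintype.card ι + 1 = 3 ^ k ∧
      ∀ m : Fin k → ZMod 3, m ≠ 0 → 3 * hammingNorm (fun x => p x ⬝ᵥ m) = 3 ^ k := by
  induction k with
  | zero =>
    exact ⟨Empty, inferInstance, Empty.elim, rfl, fun m hm => (hm (Subsingleton.elim _ _)).elim⟩
  | succ k ih =>
    obtain ⟨ι, _, p, hcard, hp⟩ := ih
    -- Projective points split into the affine part (first coordinate 1) and the hyperplane at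
    -- infinity (first coordinate 0).
    refine ⟨(Fin k → ZMod 3) ⊕ ι, inferInstance,
      Sum.elim (fun v => Fin.cons 1 v) (fun x => Fin.cons 0 (p x)), ?_, fun m hm => ?_⟩
    · rw [Fintype.card_sum, Fintype.card_fun, ZMod.card, Fintype.card_fin, pow_succ]
      omega
    · have hsplit : hammingNorm (fun x => Sum.elim (fun v => (Fin.cons 1 v : Fin (k + 1) → ZMod 3))
            (fun x => Fin.cons 0 (p x)) x ⬝ᵥ m) =
          hammingNorm (fun v : Fin k → ZMod 3 => m 0 + v ⬝ᵥ Fin.tail m) +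
            hammingNorm (fun x => p x ⬝ᵥ Fin.tail m) := by
        simp only [hammingNorm_eq_sum, Fintype.sum_sum_type, Sum.elim_inl,
          Sum.elim_inr, dotProduct, Fin.sum_univ_succ, Fin.cons_zero, Fin.cons_succ, one_mul,
          zero_mul, zero_add, Fin.tail]
      rw [hsplit, mul_add]
      by_cases ht : Fin.tail m = 0
      · have h0 : m 0 ≠ 0 := by
          intro h0
          refine hm (funext fun i => ?_)
          refine Fin.cases h0 (fun j => congrFun ht j) i
        have hz : hammingNorm (fun x : ι => p x ⬝ᵥ (0 : Fin k → ZMod 3)) = 0 := by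
          simp [hammingNorm]
        have hall : hammingNorm (fun v : Fin k → ZMod 3 =>
            m 0 + v ⬝ᵥ (0 : Fin k → ZMod 3)) = 3 ^ k := by
          simp [hammingNorm, h0, ZMod.card]
        rw [ht, hz, hall, pow_succ]
        ring
      · rw [three_mul_hammingNorm_affine _ ht, hp _ ht, pow_succ]
        ring

open Matrix in
/-- The row space of a matrix with non-degenerate Gram matrix is an LCD code. -/
theorem finrank_range_vecMul_and_isLCD {n k : ℕ} (G : Matrix (Fin k) (Fin n) (ZMod 3))
    (hG : ∀ m, m ᵥ* (G * Gᵀ) = 0 → m = 0) :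
    Module.finrank (ZMod 3) (LinearMap.range G.vecMulLinear) = k ∧
      IsLCD (LinearMap.range G.vecMulLinear) := by
  constructor
  · rw [LinearMap.finrank_range_of_inj, Module.finrank_fin_fun]
    refine (injective_iff_map_eq_zero _).2 fun m hm => hG m ?_
    rw [← vecMul_vecMul]
    have hm : m ᵥ* G = 0 := hm
    rw [hm, zero_vecMul]
  · refine (Submodule.eq_bot_iff _).2 ?_
    rintro _ ⟨⟨m, rfl⟩, hd⟩
    have : m = 0 := by
      refine hG m (funext fun j => ?_)
      rw [← vecMul_vecMul]
      have := hd (G j) ⟨Pi.single j 1, by simp [Matrix.row]⟩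
      exact this
    rw [this, map_zero]

open Matrix in
/-- Appending `s` copies of the simplex code to an LCD code. -/
theorem exists_isLCD_of_generator {n k d a s : ℕ} (G : Matrix (Fin (k + 2)) (Fin n) (ZMod 3))
    (hG : ∀ m, m ᵥ* (G * Gᵀ) = 0 → m = 0)
    (hd : ∀ m, m ≠ 0 → d ≤ hammingNorm (m ᵥ* G)) (ha : 2 * a + 1 = 3 ^ (k + 2)) :
    ∃ C : Submodule (ZMod 3) (Fin (a * s + n) → ZMod 3),
      Module.finrank (ZMod 3) C = k + 2 ∧ IsLCD C ∧
        ∀ c ∈ C, c ≠ 0 → 3 ^ (k + 1) * s + d ≤ hammingNorm c := by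
  obtain ⟨ι, _, p, hcard, hp⟩ := exists_simplex (k + 2)
  have hw : ∀ m : Fin (k + 2) → ZMod 3, m ≠ 0 →
      hammingNorm (fun x => p x ⬝ᵥ m) = 3 ^ (k + 1) := by
    intro m hm
    have := hp m hm
    rw [pow_succ] at this
    omega
  have hself : ∀ m : Fin (k + 2) → ZMod 3,
      (fun x => p x ⬝ᵥ m) ⬝ᵥ (fun x => p x ⬝ᵥ m) = 0 := by
    intro m
    rw [dotProduct_self_eq_hammingNorm]
    by_cases hm : m = 0
    · simp [hm, hammingNorm]
    · rw [hw m hm, pow_succ, Nat.cast_mul]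
      exact mul_zero _
  -- Polarising the isotropy of all simplex words makes the simplex generator rows pairwise
  -- orthogonal and isotropic.
  have horth : ∀ i j, ∑ x, p x i * p x j = 0 := by
    intro i j
    have h := dotProduct_eq_zero_of_self (hself (Pi.single i 1)) (hself (Pi.single j 1)) (by
      have := hself (Pi.single i 1 + Pi.single j 1)
      simp only [dotProduct_add] at this
      exact this)
    simp only [dotProduct_single_one] at h
    exact h
  have hcard' : Fintype.card (Fin n ⊕ Fin s × ι) = a * s + n := by
    have : Fintype.card ι = a := by omega
    simp [this, mul_comm, add_comm]
  let e : Fin (a * s + n) ≃ Fin n ⊕ Fin s × ι := (Fintype.equivFinOfCardEq hcard').symm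
  let H : Matrix (Fin (k + 2)) (Fin (a * s + n)) (ZMod 3) :=
    .of fun i x => Sum.elim (G i) (fun y => p y.2 i) (e x)
  have hgram : H * Hᵀ = G * Gᵀ := by
    ext i j
    simp only [Matrix.mul_apply, Matrix.transpose_apply, H, Matrix.of_apply]
    rw [Equiv.sum_comp e (fun x => Sum.elim (G i) (fun y => p y.2 i) x *
      Sum.elim (G j) (fun y => p y.2 j) x), Fintype.sum_sum_type]
    simp [Fintype.sum_prod_type, horth]
  have hweight : ∀ m, hammingNorm (m ᵥ* H) =
      hammingNorm (m ᵥ* G) + s * hammingNorm (fun x => p x ⬝ᵥ m) := by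
    intro m
    have : ∀ x, (m ᵥ* H) x = Sum.elim (m ᵥ* G) (fun y => p y.2 ⬝ᵥ m) (e x) := by
      intro x
      rcases h : e x with y | y <;>
        simp [H, vecMul, dotProduct, h, mul_comm]
    simp only [hammingNorm_eq_sum, this]
    rw [Equiv.sum_comp e (fun x => coordWeight (Sum.elim (m ᵥ* G) (fun y => p y.2 ⬝ᵥ m) x)),
      Fintype.sum_sum_type]
    simp [Fintype.sum_prod_type]
  obtain ⟨h1, h2⟩ := finrank_range_vecMul_and_isLCD H (by rwa [hgram])
  refine ⟨_, h1, h2, ?_⟩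
  rintro _ ⟨m, rfl⟩ hc
  have hm : m ≠ 0 := by
    rintro rfl
    exact hc (map_zero _)
  have := hd m hm
  rw [Matrix.vecMulLinear_apply, hweight, hw m hm, mul_comm s]
  omega

/-! ### Codes given by explicit bases -/

/-- The ternary vector of length `n` with the entries of `l`, reduced modulo `3`. -/
def ternaryVec (n : ℕ) (l : List ℕ) : Fin n → ZMod 3 := fun i => (l.getD i 0 : ℕ)

/-- The number of entries that are non-zero modulo `3`, as `∑ x ^ 2 % 3`. Written with the recursor,
like `listAdd`, so that the kernel evaluates it quickly. -/
def listWeight (l : List ℕ) : ℕ :=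
  l.rec 0 fun x _ w => Nat.add (Nat.mod (Nat.mul x x) 3) w

/-- The entrywise sum of two lists. -/
def listAdd (a : List ℕ) : List ℕ → List ℕ :=
  a.rec (fun _ => []) fun x _ f b => b.rec [] fun y t _ => Nat.add x y :: f t

/-- The sum of the products of corresponding entries of two lists. -/
def listDot (a b : List ℕ) : ℕ := (List.zipWith (· * ·) a b).sum

/-- Every vector in the coset of `a` by the span of the rows has weight at least `d`. -/
def cosetWeightGe (d : ℕ) : List (List ℕ) → List ℕ → Bool
  | [], a => Nat.ble d (listWeight a)
  | r :: rs, a => cosetWeightGe d rs a &&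
      (cosetWeightGe d rs (listAdd a r) && cosetWeightGe d rs (listAdd a (listAdd r r)))

/-- Every linear combination of the rows, with first non-zero coefficient `1`, has weight at least
`d`. -/
def spanWeightGe (d : ℕ) : List (List ℕ) → Bool
  | [] => true
  | r :: rs => cosetWeightGe d rs r && spanWeightGe d rs

theorem listAdd_eq_zipWith (a b : List ℕ) : listAdd a b = List.zipWith (· + ·) a b := by
  induction a generalizing b with
  | nil => rfl
  | cons x a ih =>
    cases b with
    | nil => rfl
    | cons y b => exact congrArg (List.cons (x + y)) (ih b)

theorem listAdd_length {n : ℕ} {a b : List ℕ} (ha : a.length = n) (hb : b.length = n) :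
    (listAdd a b).length = n := by
  simp [listAdd_eq_zipWith, ha, hb]

theorem ternaryVec_listAdd {n : ℕ} {a b : List ℕ} (ha : a.length = n) (hb : b.length = n) :
    ternaryVec n (listAdd a b) = ternaryVec n a + ternaryVec n b := by
  funext i
  have hia : (i : ℕ) < a.length := ha ▸ i.2
  have hib : (i : ℕ) < b.length := hb ▸ i.2
  simp [ternaryVec, listAdd_eq_zipWith, hia, hib]

theorem hammingNorm_ternaryVec (l : List ℕ) :
    hammingNorm (ternaryVec l.length l) = listWeight l := by
  induction l with
  | nil => rfl
  | cons x l ih =>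
    rw [hammingNorm_eq_sum] at ih ⊢
    have hx : coordWeight (x : ZMod 3) = x * x % 3 := by
      have h : ∀ y : ZMod 3, coordWeight y = y.val * y.val % 3 := by decide
      rw [h, ZMod.val_natCast, ← Nat.mul_mod]
    exact (Fin.sum_univ_succ _).trans (congrArg₂ _ hx ih)

theorem ternaryVec_dotProduct {n : ℕ} {a b : List ℕ} (ha : a.length = n) (hb : b.length = n) :
    ternaryVec n a ⬝ᵥ ternaryVec n b = (listDot a b : ℕ) := by
  induction n generalizing a b with
  | zero =>
    rw [List.length_eq_zero_iff.1 ha]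
    simp [listDot]
  | succ n ih =>
    obtain ⟨x, a, rfl⟩ := List.exists_cons_of_length_eq_add_one ha
    obtain ⟨y, b, rfl⟩ := List.exists_cons_of_length_eq_add_one hb
    have h := ih (a := a) (b := b) (by simpa using ha) (by simpa using hb)
    rw [dotProduct, Fin.sum_univ_succ]
    simp only [listDot, List.zipWith_cons_cons, List.sum_cons, Nat.cast_add, Nat.cast_mul]
    rw [← listDot, ← h]
    rfl

theorem zmod_three_cases (t : ZMod 3) : t = 0 ∨ t = 1 ∨ t = -1 := by
  revert t
  decide

theorem image_mem_cons {α β : Type*} (f : α → β) (a : α) (l : List α) :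
    Set.image f {x | x ∈ a :: l} = insert (f a) (Set.image f {x | x ∈ l}) := by
  rw [← Set.image_insert_eq]
  congr 1
  ext x
  simp

/-- The three branches of the check match the coefficients 0, 1, 2 = -1 of the leading row. Entries
are never reduced along the way; `listWeight` reduces modulo 3 at the end. -/
theorem le_hammingNorm_of_cosetWeightGe {n d : ℕ} {rs : List (List ℕ)}
    (hrs : ∀ r ∈ rs, r.length = n) {a : List ℕ} (ha : a.length = n)
    (h : cosetWeightGe d rs a = true) :
    ∀ v ∈ Submodule.span (ZMod 3) (Set.image (ternaryVec n) {r | r ∈ rs}),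
      d ≤ hammingNorm (ternaryVec n a + v) := by
  induction rs generalizing a with
  | nil =>
    intro v hv
    have hv : v = 0 := by simpa using hv
    subst ha
    rw [hv, add_zero, hammingNorm_ternaryVec]
    exact Nat.le_of_ble_eq_true h
  | cons r rs ih =>
    intro v hv
    have hr : r.length = n := hrs r (by simp)
    have hrs' : ∀ r ∈ rs, r.length = n := fun r' h' => hrs r' (by simp [h'])
    rw [image_mem_cons] at hv
    obtain ⟨t, z, hz, rfl⟩ := Submodule.mem_span_insert.1 hv
    simp only [cosetWeightGe, Bool.and_eq_true] at h
    obtain ⟨h0, h1, h2⟩ := h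
    rcases zmod_three_cases t with rfl | rfl | rfl
    · simpa using ih hrs' ha h0 z hz
    · rw [one_smul]
      have := ih hrs' (listAdd_length ha hr) h1 z hz
      rwa [ternaryVec_listAdd ha hr, add_assoc] at this
    · have := ih hrs' (listAdd_length ha (listAdd_length hr hr)) h2 z hz
      rwa [ternaryVec_listAdd ha (listAdd_length hr hr), ternaryVec_listAdd hr hr,
        ← two_smul (ZMod 3), add_assoc] at this

theorem le_hammingNorm_of_spanWeightGe {n d : ℕ} {rs : List (List ℕ)}
    (hrs : ∀ r ∈ rs, r.length = n) (h : spanWeightGe d rs = true) :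
    ∀ v ∈ Submodule.span (ZMod 3) (Set.image (ternaryVec n) {r | r ∈ rs}),
      v ≠ 0 → d ≤ hammingNorm v := by
  induction rs with
  | nil =>
    intro v hv h0
    exact (h0 (by simpa using hv)).elim
  | cons r rs ih =>
    intro v hv h0
    have hr : r.length = n := hrs r (by simp)
    have hrs' : ∀ r ∈ rs, r.length = n := fun r' h' => hrs r' (by simp [h'])
    rw [image_mem_cons] at hv
    obtain ⟨t, z, hz, rfl⟩ := Submodule.mem_span_insert.1 hv
    simp only [spanWeightGe, Bool.and_eq_true] at h
    obtain ⟨h1, h2⟩ := h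
    rcases zmod_three_cases t with rfl | rfl | rfl
    · rw [zero_smul, zero_add] at h0 ⊢
      exact ih hrs' h2 z hz h0
    · rw [one_smul]
      exact le_hammingNorm_of_cosetWeightGe hrs' hr h1 z hz
    -- Negation preserves weight, so a leading coefficient -1 reduces to 1.
    · have := le_hammingNorm_of_cosetWeightGe hrs' hr h1 (-z) (neg_mem hz)
      have hneg : hammingNorm ((-1 : ZMod 3) • ternaryVec n r + z) =
          hammingNorm (ternaryVec n r + -z) := by
        rw [show (-1 : ZMod 3) • ternaryVec n r + z = (-1 : ZMod 3) • (ternaryVec n r + -z) by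
          rw [smul_add, neg_one_smul, neg_one_smul, neg_neg]]
        exact hammingNorm_smul (fun _ => IsSMulRegular.of_ne_zero (by decide)) _
      rwa [hneg]

/-- `L` is a list of `k` pairwise orthogonal, non-isotropic vectors of length `n` whose span has
minimum weight at least `d`. -/
def IsLCDBasis (n k d : ℕ) (L : List (List ℕ)) : Prop :=
  L.length = k ∧ (∀ r ∈ L, r.length = n) ∧ (∀ r ∈ L, listDot r r % 3 ≠ 0) ∧
    L.Pairwise (fun a b => listDot a b % 3 = 0) ∧ spanWeightGe d L = true

instance (n k d : ℕ) (L : List (List ℕ)) : Decidable (IsLCDBasis n k d L) := by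
  unfold IsLCDBasis
  infer_instance

-- Orthogonal non-isotropic rows have an invertible diagonal Gram matrix, which yields both their
-- independence and the LCD property.
open Matrix in
theorem IsLCDBasis.exists_isLCD {n k d a : ℕ} {L : List (List ℕ)}
    (hL : IsLCDBasis n (k + 2) d L) (ha : 2 * a + 1 = 3 ^ (k + 2)) (s : ℕ) :
    ∃ C : Submodule (ZMod 3) (Fin (a * s + n) → ZMod 3),
      Module.finrank (ZMod 3) C = k + 2 ∧ IsLCD C ∧
        ∀ c ∈ C, c ≠ 0 → 3 ^ (k + 1) * s + d ≤ hammingNorm c := by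
  obtain ⟨hlen, hrow, hdiag, hpair, hspan⟩ := hL
  have hlt : ∀ i : Fin (k + 2), (i : ℕ) < L.length := fun i => by
    rw [hlen]
    exact i.2
  let G : Matrix (Fin (k + 2)) (Fin n) (ZMod 3) := fun i => ternaryVec n (L[i]'(hlt i))
  have hlenG : ∀ i : Fin (k + 2), (L[i]'(hlt i)).length = n := fun i =>
    hrow _ (List.getElem_mem _)
  have hdot : ∀ i j, G i ⬝ᵥ G j = (listDot (L[i]'(hlt i)) (L[j]'(hlt j)) : ℕ) := fun i j =>
    ternaryVec_dotProduct (hlenG i) (hlenG j)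
  have hoff : ∀ i j, i < j → G i ⬝ᵥ G j = 0 := by
    intro i j hij
    rw [hdot, ZMod.natCast_eq_zero_iff, Nat.dvd_iff_mod_eq_zero]
    exact List.pairwise_iff_getElem.1 hpair i j (hlt i) (hlt j) hij
  have hon : ∀ i, G i ⬝ᵥ G i ≠ 0 := by
    intro i
    rw [hdot, Ne, ZMod.natCast_eq_zero_iff, Nat.dvd_iff_mod_eq_zero]
    exact hdiag _ (List.getElem_mem _)
  have hgram : G * Gᵀ = diagonal fun i => G i ⬝ᵥ G i := by
    ext i j
    rcases lt_trichotomy i j with h | h | h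
    · rw [diagonal_apply_ne _ h.ne]
      exact hoff i j h
    · subst h
      rw [diagonal_apply_eq]
      rfl
    · rw [diagonal_apply_ne _ h.ne', ← hoff j i h, dotProduct_comm]
      rfl
  have hG : ∀ m, m ᵥ* (G * Gᵀ) = 0 → m = 0 := by
    intro m hm
    funext i
    have := congrFun hm i
    rw [hgram, vecMul_diagonal] at this
    exact (mul_eq_zero.1 this).resolve_right (hon i)
  refine exists_isLCD_of_generator G hG (fun m hm => ?_) ha
  refine le_hammingNorm_of_spanWeightGe hrow hspan _ ?_ fun h0 => hm (hG m ?_)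
  · rw [vecMul_eq_sum]
    exact Submodule.sum_mem _ fun i _ => Submodule.smul_mem _ _
      (Submodule.subset_span ⟨_, List.getElem_mem (hlt i), rfl⟩)
  · rw [← vecMul_vecMul, h0, zero_vecMul]

/-! ### Optimality criteria -/

/-- An LCD code whose minimum weight is at least an upper bound for LCD codes is optimal. -/
theorem isLargestLCDMinWeight_of_le {n k d : ℕ}
    (hex : ∃ C : Submodule (ZMod 3) (Fin n → ZMod 3), Module.finrank (ZMod 3) C = k + 1 ∧
      IsLCD C ∧ ∀ c ∈ C, c ≠ 0 → d ≤ hammingNorm c)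
    (hub : ∀ C : Submodule (ZMod 3) (Fin n → ZMod 3), Module.finrank (ZMod 3) C = k + 1 →
      IsLCD C → ¬ ∀ c ∈ C, c ≠ 0 → d + 1 ≤ hammingNorm c) :
    IsLargestLCDMinWeight (ZMod 3) n (k + 1) d := by
  constructor
  · obtain ⟨C, hC, hL, hd⟩ := hex
    refine ⟨C, hC, hL, ?_, ?_⟩
    · have := hub C hC hL
      push Not at this
      obtain ⟨c, hc, h0, hlt⟩ := this
      exact ⟨c, hc, h0, le_antisymm (by omega) (hd c hc h0)⟩
    · rintro _ ⟨c, hc, h0, rfl⟩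
      exact hd c hc h0
  · rintro w ⟨C, hC, hL, -, hw⟩
    by_contra hlt
    refine hub C hC hL fun c hc h0 => ?_
    have : w ≤ hammingNorm c := hw ⟨c, hc, h0, rfl⟩
    omega

/-- Optimality from the Griesmer bound. -/
theorem isLargestLCDMinWeight_of_griesmer {n k d : ℕ}
    (hex : ∃ C : Submodule (ZMod 3) (Fin n → ZMod 3), Module.finrank (ZMod 3) C = k + 1 ∧
      IsLCD C ∧ ∀ c ∈ C, c ≠ 0 → d ≤ hammingNorm c)
    (hn : n < griesmerLength (k + 1) (d + 1)) :
    IsLargestLCDMinWeight (ZMod 3) n (k + 1) d := by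
  refine isLargestLCDMinWeight_of_le hex fun C hC _ hd => ?_
  have := griesmerLength_le_card hC Finset.univ hd
  rw [Finset.card_univ, Fintype.card_fin] at this
  omega

/-- Optimality from the non-existence of LCD codes meeting the Griesmer bound. -/
theorem isLargestLCDMinWeight_of_eq_griesmer {n k d e : ℕ}
    (hex : ∃ C : Submodule (ZMod 3) (Fin n → ZMod 3), Module.finrank (ZMod 3) C = k + 1 ∧
      IsLCD C ∧ ∀ c ∈ C, c ≠ 0 → d ≤ hammingNorm c)
    (he : d + 1 = 3 * e) (hn : n = griesmerLength (k + 1) (3 * e)) :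
    IsLargestLCDMinWeight (ZMod 3) n (k + 1) d := by
  refine isLargestLCDMinWeight_of_le hex fun C hC hL hd => ?_
  rw [he] at hd
  exact not_isLCD_of_eq_griesmerLength hC hn hd hL

/-! ### Starting codes for s = 0 and the final assembly -/

/-- The rows of an orthogonal basis of a ternary LCD `[17, 5, 9]` code. -/
def lcdBasis17_5 : List (List ℕ) :=
  [[0, 0, 0, 1, 0, 2, 2, 0, 1, 2, 2, 1, 2, 0, 0, 2, 2],
   [0, 0, 0, 2, 1, 2, 0, 1, 0, 0, 1, 0, 1, 1, 1, 2, 2],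
   [1, 0, 0, 1, 2, 1, 2, 0, 2, 1, 2, 0, 1, 0, 2, 2, 0],
   [1, 1, 1, 0, 0, 2, 1, 2, 2, 2, 2, 2, 0, 1, 0, 0, 0],
   [0, 1, 2, 0, 0, 2, 2, 2, 2, 1, 1, 1, 1, 1, 2, 0, 2]]

/-- The rows of an orthogonal basis of a ternary LCD `[13, 6, 6]` code. -/
def lcdBasis13_6 : List (List ℕ) :=
  [[0, 0, 0, 0, 0, 1, 2, 2, 2, 1, 2, 1, 1],
   [1, 0, 0, 0, 0, 1, 1, 2, 1, 1, 1, 0, 0],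
   [2, 1, 1, 0, 0, 2, 2, 2, 1, 1, 0, 1, 1],
   [0, 1, 2, 0, 0, 1, 1, 2, 1, 2, 0, 1, 0],
   [2, 0, 0, 1, 1, 2, 2, 0, 1, 1, 1, 2, 2],
   [0, 0, 0, 1, 2, 2, 2, 0, 1, 2, 2, 0, 1]]

/-- The rows of an orthogonal basis of a ternary LCD `[18, 6, 9]` code. -/
def lcdBasis18_6 : List (List ℕ) :=
  [[0, 0, 0, 0, 1, 0, 1, 2, 0, 0, 2, 2, 2, 2, 1, 0, 1, 1],
   [1, 0, 0, 0, 1, 0, 1, 1, 1, 2, 0, 2, 2, 1, 2, 0, 2, 0],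
   [0, 1, 1, 0, 0, 0, 2, 2, 1, 0, 1, 2, 2, 1, 0, 0, 2, 1],
   [2, 1, 2, 0, 0, 0, 2, 0, 1, 0, 0, 1, 1, 2, 0, 2, 2, 0],
   [2, 1, 0, 1, 0, 1, 2, 0, 2, 2, 1, 2, 2, 1, 2, 0, 2, 0],
   [2, 2, 0, 1, 0, 2, 2, 0, 0, 0, 0, 1, 2, 1, 1, 2, 1, 0]]

/-- The rows of an orthogonal basis of a ternary LCD `[14, 7, 6]` code. -/
def lcdBasis14_7 : List (List ℕ) :=
  [[0, 0, 0, 0, 0, 1, 0, 2, 2, 2, 1, 2, 1, 1],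
   [1, 0, 0, 0, 0, 1, 0, 1, 2, 1, 1, 1, 0, 0],
   [0, 0, 0, 0, 0, 2, 1, 2, 0, 1, 1, 0, 2, 1],
   [1, 1, 0, 0, 0, 2, 1, 2, 2, 2, 1, 0, 0, 0],
   [2, 0, 1, 1, 0, 2, 2, 2, 0, 0, 0, 0, 2, 1],
   [2, 2, 1, 2, 0, 1, 2, 1, 1, 0, 0, 0, 2, 2],
   [2, 1, 1, 2, 1, 1, 2, 1, 2, 2, 1, 1, 2, 2]]

/-- The rows of an orthogonal basis of a ternary LCD `[10, 4, 5]` code. -/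
def lcdBasis10_4 : List (List ℕ) :=
  [[1, 0, 0, 0, 2, 0, 1, 0, 1, 1],
   [0, 0, 0, 1, 2, 1, 2, 2, 1, 2],
   [0, 1, 0, 1, 1, 0, 0, 1, 1, 0],
   [2, 1, 1, 1, 1, 2, 2, 1, 2, 1]]

/-- The rows of an orthogonal basis of a ternary LCD `[11, 5, 5]` code. -/
def lcdBasis11_5 : List (List ℕ) :=
  [[1, 0, 0, 0, 0, 2, 0, 1, 0, 1, 1],
   [2, 1, 1, 0, 0, 2, 1, 0, 2, 1, 2],
   [1, 1, 2, 0, 0, 2, 0, 2, 2, 2, 0],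
   [1, 1, 2, 0, 1, 0, 0, 0, 0, 0, 2],
   [0, 1, 2, 1, 1, 1, 1, 1, 0, 0, 0]]

/-- The rows of an orthogonal basis of a ternary LCD `[15, 5, 8]` code. -/
def lcdBasis15_5 : List (List ℕ) :=
  [[1, 0, 0, 0, 0, 2, 1, 2, 1, 1, 0, 0, 2, 2, 0],
   [2, 1, 1, 0, 0, 1, 1, 0, 0, 1, 1, 0, 2, 1, 2],
   [2, 1, 2, 0, 0, 0, 0, 1, 0, 0, 0, 2, 2, 2, 1],
   [0, 0, 2, 1, 1, 0, 0, 2, 1, 0, 1, 0, 0, 2, 2],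
   [2, 0, 1, 1, 2, 0, 0, 1, 0, 1, 1, 1, 2, 0, 2]]

/-- The rows of an orthogonal basis of a ternary LCD `[12, 6, 5]` code. -/
def lcdBasis12_6 : List (List ℕ) :=
  [[1, 0, 0, 0, 0, 0, 2, 0, 1, 0, 1, 1],
   [2, 0, 0, 0, 0, 1, 2, 2, 2, 2, 1, 0],
   [2, 1, 0, 0, 0, 1, 1, 1, 0, 1, 1, 1],
   [0, 0, 1, 1, 0, 1, 0, 2, 2, 2, 2, 2],
   [2, 1, 1, 2, 0, 1, 0, 2, 1, 1, 2, 1],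
   [2, 2, 1, 1, 1, 2, 1, 2, 1, 0, 1, 0]]

/-- The rows of an orthogonal basis of a ternary LCD `[13, 7, 5]` code. -/
def lcdBasis13_7 : List (List ℕ) :=
  [[0, 0, 1, 0, 0, 0, 0, 2, 1, 1, 0, 2, 0],
   [1, 0, 1, 0, 0, 0, 0, 2, 0, 2, 2, 1, 2],
   [2, 0, 1, 1, 0, 0, 0, 1, 0, 2, 2, 2, 0],
   [1, 1, 1, 1, 0, 0, 0, 0, 1, 2, 1, 1, 0],
   [0, 1, 0, 0, 1, 0, 0, 1, 0, 1, 0, 0, 1],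
   [2, 2, 1, 0, 0, 1, 1, 0, 2, 0, 2, 0, 1],
   [0, 0, 2, 2, 1, 1, 2, 0, 0, 1, 0, 0, 1]]

/-- The rows of an orthogonal basis of a ternary LCD `[14, 8, 5]` code. -/
def lcdBasis14_8 : List (List ℕ) :=
  [[1, 0, 0, 0, 0, 0, 0, 0, 2, 0, 1, 0, 1, 1],
   [2, 0, 0, 0, 0, 0, 1, 0, 0, 1, 0, 2, 0, 1],
   [2, 1, 0, 0, 0, 0, 1, 0, 2, 0, 1, 1, 0, 2],
   [0, 0, 0, 0, 0, 0, 2, 1, 2, 2, 2, 0, 1, 2],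
   [0, 1, 1, 0, 0, 0, 1, 1, 1, 2, 2, 0, 2, 0],
   [0, 2, 0, 0, 0, 1, 1, 2, 2, 0, 1, 2, 0, 1],
   [2, 1, 2, 1, 0, 1, 2, 2, 1, 1, 2, 2, 2, 1],
   [2, 2, 2, 0, 1, 1, 1, 2, 2, 1, 1, 1, 1, 1]]

theorem isLCDBasis17_5 : IsLCDBasis 17 5 9 lcdBasis17_5 := by
  decide +kernel

theorem isLCDBasis13_6 : IsLCDBasis 13 6 6 lcdBasis13_6 := by
  decide +kernel

theorem isLCDBasis18_6 : IsLCDBasis 18 6 9 lcdBasis18_6 := by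
  decide +kernel

theorem isLCDBasis14_7 : IsLCDBasis 14 7 6 lcdBasis14_7 := by
  decide +kernel

theorem isLCDBasis10_4 : IsLCDBasis 10 4 5 lcdBasis10_4 := by
  decide +kernel

theorem isLCDBasis11_5 : IsLCDBasis 11 5 5 lcdBasis11_5 := by
  decide +kernel

theorem isLCDBasis15_5 : IsLCDBasis 15 5 8 lcdBasis15_5 := by
  decide +kernel

theorem isLCDBasis12_6 : IsLCDBasis 12 6 5 lcdBasis12_6 := by
  decide +kernel

theorem isLCDBasis13_7 : IsLCDBasis 13 7 5 lcdBasis13_7 := by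
  decide +kernel

theorem isLCDBasis14_8 : IsLCDBasis 14 8 5 lcdBasis14_8 := by
  decide +kernel

theorem mainTheorem4 (s : ℕ) :
    (IsLargestLCDMinWeight (ZMod 3) (121 * s + 17) 5 (81 * s + 9) ∧
      IsLargestLCDMinWeight (ZMod 3) (364 * s + 13) 6 (243 * s + 6) ∧
      IsLargestLCDMinWeight (ZMod 3) (364 * s + 18) 6 (243 * s + 9) ∧
      IsLargestLCDMinWeight (ZMod 3) (1093 * s + 14) 7 (729 * s + 6)) ∧
    (IsLargestLCDMinWeight (ZMod 3) (40 * s + 10) 4 (27 * s + 5) ∧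
      IsLargestLCDMinWeight (ZMod 3) (121 * s + 11) 5 (81 * s + 5) ∧
      IsLargestLCDMinWeight (ZMod 3) (121 * s + 15) 5 (81 * s + 8) ∧
      IsLargestLCDMinWeight (ZMod 3) (364 * s + 12) 6 (243 * s + 5) ∧
      IsLargestLCDMinWeight (ZMod 3) (1093 * s + 13) 7 (729 * s + 5) ∧
      IsLargestLCDMinWeight (ZMod 3) (3280 * s + 14) 8 (2187 * s + 5)) := by
  refine ⟨⟨?_, ?_, ?_, ?_⟩, ?_, ?_, ?_, ?_, ?_, ?_⟩
  · exact isLargestLCDMinWeight_of_griesmer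
      (isLCDBasis17_5.exists_isLCD (by norm_num) s)
      (by simp only [griesmerLength]; omega)
  · exact isLargestLCDMinWeight_of_griesmer
      (isLCDBasis13_6.exists_isLCD (by norm_num) s)
      (by simp only [griesmerLength]; omega)
  · exact isLargestLCDMinWeight_of_griesmer
      (isLCDBasis18_6.exists_isLCD (by norm_num) s)
      (by simp only [griesmerLength]; omega)
  · exact isLargestLCDMinWeight_of_griesmer
      (isLCDBasis14_7.exists_isLCD (by norm_num) s)
      (by simp only [griesmerLength]; omega)
  -- Here and below e = (d + 1) / 3; for instance 27s + 6 = 3(9s + 2).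
  · exact isLargestLCDMinWeight_of_eq_griesmer (e := 9 * s + 2)
      (isLCDBasis10_4.exists_isLCD (by norm_num) s)
      (by omega) (by simp only [griesmerLength]; omega)
  · exact isLargestLCDMinWeight_of_eq_griesmer (e := 27 * s + 2)
      (isLCDBasis11_5.exists_isLCD (by norm_num) s)
      (by omega) (by simp only [griesmerLength]; omega)
  · exact isLargestLCDMinWeight_of_eq_griesmer (e := 27 * s + 3)
      (isLCDBasis15_5.exists_isLCD (by norm_num) s)
      (by omega) (by simp only [griesmerLength]; omega)
  · exact isLargestLCDMinWeight_of_eq_griesmer (e := 81 * s + 2)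
      (isLCDBasis12_6.exists_isLCD (by norm_num) s)
      (by omega) (by simp only [griesmerLength]; omega)
  · exact isLargestLCDMinWeight_of_eq_griesmer (e := 243 * s + 2)
      (isLCDBasis13_7.exists_isLCD (by norm_num) s)
      (by omega) (by simp only [griesmerLength]; omega)
  · exact isLargestLCDMinWeight_of_eq_griesmer (e := 729 * s + 2)
      (isLCDBasis14_8.exists_isLCD (by norm_num) s)
      (by omega) (by simp only [griesmerLength]; omega)
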